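/- Throughout, a finite geometric simplicial complex in $\mathbb R^n$ is a finite collection $K$ of simplices of $\mathbb R^n$, closed under passing to (nonempty) faces, such that any two simplices meet in a common (possibly empty) face; $|K|\subset\mathbb R^n$ is the union of its simplices. The open star $|\mathrm{St}(w)|$ of a vertex $w$ is the union of the open simplices (points with all barycentric coordinates positive; the open simplex of a single point is that point) spanned by the simplices that contain $w$. The closed star $\overline{\mathrm{St}}(v)$ of a vertex $v$ is the set of all faces of simplices containing $v$; its vertices are $v$ and its neighbours. Let $K$ and $L$ be complexes and let $f$ be a map that sends $|K|$ to $|L|$. The map $f$ satisfies the *star condition* if for every vertex $v$ of $K$ there is a vertex $w$ of $L$ with $f(|\overline{\mathrm{St}}(v)|)\subseteq|\mathrm{St}(w)|$, and the *weak star condition* if for every vertex $v$ of $K$ there is a vertex $w$ of $L$ such that $f(u)\in|\mathrm{St}(w)|$ for every vertex $u$ of $\overline{\mathrm{St}}(v)$. A *weak simplicial approximation* to $f$ is a map $g$ from the vertices of $K$ to the vertices of $L$ such that $f(u)\in|\mathrm{St}(g(v))|$ for every vertex $v$ of $K$ and every vertex $u$ of $\overline{\mathrm{St}}(v)$. Let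 $\mathrm{Sub}$ be one of the following two subdivisions, which do not change the underlying space. * Barycentric: the simplices of $\mathrm{Sub}(K)$ are spanned by the barycenters of the members of chains $\sigma_0\subsetneq\dots\subsetneq\sigma_k$ of simplices of $K$. * Edgewise: $K$ carries a relation $\le$ which is a total order on the vertices of each simplex (for instance a total order on all vertices). The simplices of $\mathrm{Sub}(K)$ are spanned by the midpoints $\tfrac12(a_0+b_0),\dots,\tfrac12(a_k+b_k)$, where $a_0\le\dots\le a_k\le b_0\le\dots\le b_k$ are vertices (repetitions allowed) of one simplex of $K$. The vertices of such a simplex are ordered by $\tfrac12(a_i+b_i)\le\tfrac12(a_j+b_j)$ for $i\le j$, and this order is used for the next subdivision. **Proposition.** Let $K$, $L$ be finite geometric simplicial complexes in $\mathbb R^n$ and $\mathbb R^m$, and let $f\colon|K|\to|L|$ be continuous. For each of the two subdivision methods (and, in the edgewise case, for every such order on $K$), the following algorithm terminates: while $f$ does not satisfy the weak star condition with respect to the current complex $K$, replace $K$ by $\mathrm{Sub}(K)$; then return a weak simplicial approximation $g$ to $f$. That is, there is $N\ge 0$ such that $f\colon|\mathrm{Sub}^i(K)|\to|L|$ fails the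 weak star condition for all $i<N$ and satisfies it for $i=N$, and a weak simplicial approximation to $f\colon|\mathrm{Sub}^N(K)|\to|L|$ exists. The same holds if the loop tests the star condition instead of the weak star condition. -/

import Mathlib

/-! Finite geometric simplicial complexes are `Geometry.SimplicialComplex ℝ E` with finitely many
faces. This file builds their barycentric and edgewise subdivisions, and the (weak) star condition. -/

namespace SimplicialApprox

set_option linter.unusedSectionVars false

open Geometry

variable {E F : Type*} [AddCommGroup E] [Module ℝ E] [AddCommGroup F] [Module ℝ F]

/-! ### Gluing lemmas, needed to see that the subdivisions are geometric simplicial complexes -/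

section Glue

/-- Barycentric coordinates in an affinely independent set are unique. -/
theorem coord_unique {s : Finset E} (hs : AffineIndependent ℝ ((↑) : s → E)) {x z : E → ℝ}
    (h1 : ∑ v ∈ s, x v = ∑ v ∈ s, z v) (h2 : ∑ v ∈ s, x v • v = ∑ v ∈ s, z v • v) :
    ∀ v ∈ s, x v = z v := by
  rw [affineIndependent_iff_of_fintype] at hs
  intro v hv
  have h := hs (fun i => x i - z i) ?_ ?_ ⟨v, hv⟩
  · simpa [sub_eq_zero] using h
  · rw [Finset.univ_eq_attach, Finset.sum_attach s (fun v => x v - z v), Finset.sum_sub_distrib, h1,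
      sub_self]
  · have h0 : ∑ i : s, (x i - z i) = 0 := by
      rw [Finset.univ_eq_attach, Finset.sum_attach s (fun v => x v - z v), Finset.sum_sub_distrib,
        h1, sub_self]
    rw [Finset.weightedVSub_eq_linear_combination _ h0, Finset.univ_eq_attach,
      Finset.sum_attach s (fun v => (x v - z v) • v)]
    simp only [sub_smul]
    rw [Finset.sum_sub_distrib, h2, sub_self]

/-- Barycentric coordinates in a geometric simplicial complex are unique. -/
theorem coord_unique_complex (K : SimplicialComplex ℝ E) {s t : Finset E} (hs : s ∈ K.faces)
    (ht : t ∈ K.faces) {x y : E → ℝ} (hx : ∀ v, 0 ≤ x v) (hy : ∀ v, 0 ≤ y v)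
    (hxs : ∀ v ∉ s, x v = 0) (hyt : ∀ v ∉ t, y v = 0)
    (hx1 : ∑ v ∈ s, x v = 1) (hy1 : ∑ v ∈ t, y v = 1)
    (hxy : ∑ v ∈ s, x v • v = ∑ v ∈ t, y v • v) : x = y := by
  classical
  have mx : ∑ v ∈ s, x v • v ∈ convexHull ℝ (s : Set E) :=
    Finset.mem_convexHull'.2 ⟨x, fun v _ => hx v, hx1, rfl⟩
  have my : ∑ v ∈ s, x v • v ∈ convexHull ℝ (t : Set E) :=
    Finset.mem_convexHull'.2 ⟨y, fun v _ => hy v, hy1, hxy.symm⟩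
  have mz := K.inter_subset_convexHull hs ht ⟨mx, my⟩
  rw [← Finset.coe_inter] at mz
  obtain ⟨w, hw0, hw1, hw2⟩ := Finset.mem_convexHull'.1 mz
  set z : E → ℝ := fun v => if v ∈ s ∩ t then w v else 0 with hz
  have sum_of : ∀ r : Finset E, s ∩ t ⊆ r → ∑ v ∈ r, z v = 1 ∧
      ∑ v ∈ r, z v • v = ∑ v ∈ s, x v • v := by
    intro r hr
    constructor
    · rw [← hw1, hz, Finset.sum_ite_mem, Finset.inter_eq_right.2 hr]
    · rw [← hw2, hz]
      simp only [ite_smul, zero_smul]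
      rw [Finset.sum_ite_mem, Finset.inter_eq_right.2 hr]
  have h1 := sum_of s Finset.inter_subset_left
  have h2 := sum_of t Finset.inter_subset_right
  have e1 := coord_unique (K.indep hs) (hx1.trans h1.1.symm) h1.2.symm
  have e2 := coord_unique (K.indep ht) (hy1.trans h2.1.symm) (hxy.symm.trans h2.2.symm)
  have xz : x = z := by
    funext v
    by_cases hv : v ∈ s
    · exact e1 v hv
    · rw [hxs v hv, hz]; simp [hv]
  have yz : y = z := by
    funext v
    by_cases hv : v ∈ t
    · exact e2 v hv
    · rw [hyt v hv, hz]; simp [hv]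
  rw [xz, yz]

/-- `pos i` is the point with barycentric coordinates `c i` in a common face of `K`, for all `i`
in a simplex `T` of `𝒯`, and nonnegative combinations over simplices of `𝒯` determine their
coefficients. -/
structure GlueData (K : SimplicialComplex ℝ E) {I : Type*} (c : I → E → ℝ) (pos : I → E)
    (𝒯 : Set (Finset I)) : Prop where
  nonneg : ∀ i v, 0 ≤ c i v
  carrier : ∀ T ∈ 𝒯, ∃ s ∈ K.faces, ∀ i ∈ T, (∀ v ∉ s, c i v = 0) ∧ ∑ v ∈ s, c i v = 1 ∧
    ∑ v ∈ s, c i v • v = pos i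
  unique : ∀ T ∈ 𝒯, ∀ T' ∈ 𝒯, ∀ m m' : I → ℝ, (∀ i, 0 ≤ m i) → (∀ i, 0 ≤ m' i) →
    (∀ i ∉ T, m i = 0) → (∀ i ∉ T', m' i = 0) →
    (∀ v, ∑ i ∈ T, m i * c i v = ∑ i ∈ T', m' i * c i v) → m = m'

variable {K : SimplicialComplex ℝ E} {I : Type*} {c : I → E → ℝ} {pos : I → E}
  {𝒯 : Set (Finset I)}

theorem GlueData.weights_eq (G : GlueData K c pos 𝒯) {T T' : Finset I} (hT : T ∈ 𝒯) (hT' : T' ∈ 𝒯)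
    {m m' : I → ℝ} (hm : ∀ i, 0 ≤ m i) (hm' : ∀ i, 0 ≤ m' i) (hmT : ∀ i ∉ T, m i = 0)
    (hmT' : ∀ i ∉ T', m' i = 0) (h1 : ∑ i ∈ T, m i = 1) (h1' : ∑ i ∈ T', m' i = 1)
    (h : ∑ i ∈ T, m i • pos i = ∑ i ∈ T', m' i • pos i) : m = m' := by
  have key : ∀ (T : Finset I) (s : Finset E) (m : I → ℝ), ∑ i ∈ T, m i = 1 →
      (∀ i ∈ T, (∀ v ∉ s, c i v = 0) ∧ ∑ v ∈ s, c i v = 1 ∧ ∑ v ∈ s, c i v • v = pos i) →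
      (∀ v ∉ s, ∑ i ∈ T, m i * c i v = 0) ∧ ∑ v ∈ s, ∑ i ∈ T, m i * c i v = 1 ∧
      ∑ v ∈ s, (∑ i ∈ T, m i * c i v) • v = ∑ i ∈ T, m i • pos i := by
    intro T s m h1 h
    refine ⟨fun v hv => Finset.sum_eq_zero fun i hi => by rw [(h i hi).1 v hv, mul_zero], ?_, ?_⟩
    · rw [Finset.sum_comm, ← h1]
      refine Finset.sum_congr rfl fun i hi => ?_
      rw [← Finset.mul_sum, (h i hi).2.1, mul_one]
    · simp only [Finset.sum_smul]
      rw [Finset.sum_comm]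
      refine Finset.sum_congr rfl fun i hi => ?_
      rw [← (h i hi).2.2, Finset.smul_sum]
      simp only [mul_smul]
  obtain ⟨s, hs, hsT⟩ := G.carrier T hT
  obtain ⟨s', hs', hsT'⟩ := G.carrier T' hT'
  obtain ⟨k0, k1, k2⟩ := key T s m h1 hsT
  obtain ⟨k0', k1', k2'⟩ := key T' s' m' h1' hsT'
  have := coord_unique_complex K hs hs'
    (x := fun v => ∑ i ∈ T, m i * c i v) (y := fun v => ∑ i ∈ T', m' i * c i v)
    (fun v => Finset.sum_nonneg fun i _ => mul_nonneg (hm i) (G.nonneg i v))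
    (fun v => Finset.sum_nonneg fun i _ => mul_nonneg (hm' i) (G.nonneg i v))
    k0 k0' k1 k1' (by rw [k2, k2', h])
  exact G.unique T hT T' hT' m m' hm hm' hmT hmT' (fun v => congrFun this v)

theorem GlueData.pos_inj (G : GlueData K c pos 𝒯) {T T' : Finset I} (hT : T ∈ 𝒯) (hT' : T' ∈ 𝒯)
    {i j : I} (hi : i ∈ T) (hj : j ∈ T') (h : pos i = pos j) : i = j := by
  classical
  have := G.weights_eq hT hT' (m := fun k => if k = i then 1 else 0)
    (m' := fun k => if k = j then 1 else 0) (fun k => by positivity)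
    (fun k => by positivity)
    (fun k hk => if_neg (by rintro rfl; exact hk hi))
    (fun k hk => if_neg (by rintro rfl; exact hk hj))
    (by simp [hi]) (by simp [hj]) (by simp [hi, hj, h])
  have := congrFun this i
  by_contra hne
  simp [hne] at this

theorem GlueData.indep (G : GlueData K c pos 𝒯) {T : Finset I} (hT : T ∈ 𝒯) :
    AffineIndependent ℝ (fun i : T => pos i) := by
  classical
  rw [affineIndependent_iff_of_fintype]
  intro w hw0 hw1 i
  rw [Finset.weightedVSub_eq_linear_combination _ hw0] at hw1
  set W : I → ℝ := fun i => if h : i ∈ T then w ⟨i, h⟩ else 0 with hW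
  have hWw : ∀ i : T, W i = w i := fun i => by simp [hW]
  have hWT : ∀ i ∉ T, W i = 0 := fun i hi => by simp [hW, hi]
  have s0 : ∑ i ∈ T, W i = 0 := by
    rw [← Finset.sum_attach, ← Finset.univ_eq_attach]; simpa only [hWw] using hw0
  have s1 : ∑ i ∈ T, W i • pos i = 0 := by
    rw [← Finset.sum_attach, ← Finset.univ_eq_attach]; simpa only [hWw] using hw1
  rw [← hWw i]
  have pm : ∀ i, W i = max (W i) 0 - max (-W i) 0 := fun i => by
    rcases le_total (W i) 0 with h | h
    · rw [max_eq_right h, max_eq_left (by linarith)]; ring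
    · rw [max_eq_left h, max_eq_right (by linarith)]; ring
  set S := ∑ i ∈ T, max (W i) 0 with hS
  have eS : ∑ i ∈ T, max (-W i) 0 = S := by
    have : ∑ i ∈ T, W i = S - ∑ i ∈ T, max (-W i) 0 := by
      rw [hS, ← Finset.sum_sub_distrib]; exact Finset.sum_congr rfl fun i _ => pm i
    linarith
  have e1 : ∑ i ∈ T, max (W i) 0 • pos i = ∑ i ∈ T, max (-W i) 0 • pos i := by
    rw [← sub_eq_zero, ← Finset.sum_sub_distrib, ← s1]
    refine Finset.sum_congr rfl fun i _ => ?_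
    rw [← sub_smul, ← pm]
  have S0 : 0 ≤ S := Finset.sum_nonneg fun i _ => le_max_right _ _
  rcases S0.eq_or_lt with h | h
  · have a := (Finset.sum_eq_zero_iff_of_nonneg (fun i _ => le_max_right (W i) 0)).1
      (hS.symm.trans h.symm) i i.2
    have b := (Finset.sum_eq_zero_iff_of_nonneg (fun i _ => le_max_right (-W i) 0)).1
      (eS.trans h.symm) i i.2
    rw [pm, a, b, sub_zero]
  · have := G.weights_eq hT hT (m := fun i => S⁻¹ * max (W i) 0) (m' := fun i => S⁻¹ * max (-W i) 0)
      (fun i => mul_nonneg (by positivity) (le_max_right _ _))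
      (fun i => mul_nonneg (by positivity) (le_max_right _ _))
      (fun i hi => by simp [hWT i hi]) (fun i hi => by simp [hWT i hi])
      (by rw [← Finset.mul_sum, ← hS, inv_mul_cancel₀ h.ne'])
      (by rw [← Finset.mul_sum, eS, inv_mul_cancel₀ h.ne'])
      (by simp only [mul_smul]; rw [← Finset.smul_sum, ← Finset.smul_sum, e1])
    have := mul_left_cancel₀ (inv_ne_zero h.ne') (congrFun this i)
    rw [pm, this, sub_self]

theorem GlueData.indep_image (G : GlueData K c pos 𝒯) {T : Finset I} (hT : T ∈ 𝒯) {t : Finset E}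
    (ht : (t : Set E) = pos '' T) : AffineIndependent ℝ ((↑) : t → E) := by
  have h := (G.indep hT).range
  have e : Set.range (fun i : T => pos i) = (t : Set E) := by
    rw [ht]; ext x; simp
  rw [e] at h
  exact h

theorem mem_hull_image {T : Finset I} {x : E} (hx : x ∈ convexHull ℝ (pos '' (T : Set I))) :
    ∃ m : I → ℝ, (∀ i, 0 ≤ m i) ∧ (∀ i ∉ T, m i = 0) ∧ ∑ i ∈ T, m i = 1 ∧
      ∑ i ∈ T, m i • pos i = x := by
  classical
  have e : pos '' (T : Set I) = ⋃ i ∈ T, {pos i} := by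
    ext y; simp [eq_comm]
  have hc : Convex ℝ {x | ∃ m : I → ℝ, (∀ i, 0 ≤ m i) ∧ (∀ i ∉ T, m i = 0) ∧ ∑ i ∈ T, m i = 1 ∧
      ∑ i ∈ T, m i • pos i = x} := by
    rintro _ ⟨m, h0, h1, h2, rfl⟩ _ ⟨m', h0', h1', h2', rfl⟩ a b ha hb hab
    refine ⟨fun i => a * m i + b * m' i, fun i => add_nonneg (mul_nonneg ha (h0 i))
      (mul_nonneg hb (h0' i)), fun i hi => by simp [h1 i hi, h1' i hi], ?_, ?_⟩
    · rw [Finset.sum_add_distrib, ← Finset.mul_sum, ← Finset.mul_sum, h2, h2', mul_one, mul_one, hab]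
    · simp only [add_smul, mul_smul]
      rw [Finset.sum_add_distrib, ← Finset.smul_sum, ← Finset.smul_sum]
  refine convexHull_min ?_ hc hx
  rintro _ ⟨i, hi, rfl⟩
  have hi' : i ∈ T := hi
  exact ⟨fun k => if k = i then 1 else 0, fun k => by positivity,
    fun k hk => if_neg (by rintro rfl; exact hk hi'), by simp [hi'], by simp [hi']⟩

theorem GlueData.inter (G : GlueData K c pos 𝒯) {T T' : Finset I} (hT : T ∈ 𝒯) (hT' : T' ∈ 𝒯)
    {t t' : Finset E} (ht : (t : Set E) = pos '' T) (ht' : (t' : Set E) = pos '' T') :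
    convexHull ℝ (t : Set E) ∩ convexHull ℝ (t' : Set E) ⊆ convexHull ℝ (t ∩ t' : Set E) := by
  classical
  rintro x ⟨hx, hx'⟩
  rw [ht] at hx
  rw [ht'] at hx'
  obtain ⟨m, h0, h1, h2, h3⟩ := mem_hull_image hx
  obtain ⟨m', h0', h1', h2', h3'⟩ := mem_hull_image hx'
  have e := G.weights_eq hT hT' h0 h0' h1 h1' h2 h2' (h3.trans h3'.symm)
  subst e
  rw [← h3]
  have hz : ∀ i ∈ T, i ∉ T.filter (· ∈ T') → m i = 0 := by
    intro i hi hi'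
    exact h1' i fun h => hi' (Finset.mem_filter.2 ⟨hi, h⟩)
  rw [← Finset.sum_subset (Finset.filter_subset (· ∈ T') T)
    (fun i hi hi' => by rw [hz i hi hi', zero_smul])]
  refine (convex_convexHull ℝ _).sum_mem (fun i _ => h0 i) ?_ ?_
  · rw [Finset.sum_subset (Finset.filter_subset (· ∈ T') T) hz, h2]
  · intro i hi
    rw [Finset.mem_filter] at hi
    apply subset_convexHull
    rw [ht, ht']
    exact ⟨⟨i, hi.1, rfl⟩, ⟨i, hi.2, rfl⟩⟩

/-- A function on a finite set with a relation along which a height drops strictly is determined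
by its sums over the sets of relatives of each element. -/
theorem eq_of_sums_eq (A : Finset I) (r : I → I → Prop) [DecidableRel r] (h : I → ℤ)
    (hrefl : ∀ i ∈ A, r i i) (hlt : ∀ i ∈ A, ∀ j ∈ A, r i j → i ≠ j → h j < h i) (k k' : I → ℝ)
    (hk : ∀ i ∈ A, ∑ j ∈ A with r i j, k j = ∑ j ∈ A with r i j, k' j) :
    ∀ i ∈ A, k i = k' i := by
  classical
  by_contra hcon
  push Not at hcon
  obtain ⟨i0, hi0, hne0⟩ := hcon
  obtain ⟨i, hi, hmin⟩ := Finset.exists_min_image (A.filter fun i => k i ≠ k' i) h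
    ⟨i0, Finset.mem_filter.2 ⟨hi0, hne0⟩⟩
  rw [Finset.mem_filter] at hi
  have hmem : i ∈ A.filter (fun j => r i j) := Finset.mem_filter.2 ⟨hi.1, hrefl i hi.1⟩
  have := hk i hi.1
  rw [← Finset.add_sum_erase _ k hmem, ← Finset.add_sum_erase _ k' hmem] at this
  have e : ∑ j ∈ (A.filter (fun j => r i j)).erase i, k j =
      ∑ j ∈ (A.filter (fun j => r i j)).erase i, k' j := by
    refine Finset.sum_congr rfl fun j hj => ?_
    rw [Finset.mem_erase, Finset.mem_filter] at hj
    by_contra hne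
    exact absurd (hmin j (Finset.mem_filter.2 ⟨hj.2.1, hne⟩))
      (not_le.2 (hlt i hi.1 j hj.2.1 hj.2.2 hj.1.symm))
  rw [e] at this
  exact hi.2 (by linarith)

end Glue

/-! ### Barycentric subdivision -/

/-- The barycenter of a finite set of points. -/
noncomputable def barycenter (s : Finset E) : E := (s.card : ℝ)⁻¹ • ∑ v ∈ s, v

/-- The flags of `K`: nonempty finite sets of simplices of `K`, totally ordered by inclusion. -/
def flags (K : SimplicialComplex ℝ E) : Set (Finset (Finset E)) :=
  {C | C.Nonempty ∧ (∀ s ∈ C, s ∈ K.faces) ∧ ∀ s ∈ C, ∀ t ∈ C, s ⊆ t ∨ t ⊆ s}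

theorem flag_point {C : Finset (Finset E)} (hC : ∀ s ∈ C, ∀ t ∈ C, s ⊆ t ∨ t ⊆ s) {a : Finset E}
    (ha : a.Nonempty) : ∃ v ∈ a, ∀ s ∈ C, v ∈ s → a ⊆ s := by
  classical
  by_cases h : (C.filter fun s => ¬ a ⊆ s).Nonempty
  · obtain ⟨t, ht, hmax⟩ := Finset.exists_max_image _ (fun s : Finset E => s.card) h
    rw [Finset.mem_filter] at ht
    obtain ⟨v, hva, hvt⟩ := Finset.not_subset.1 ht.2
    refine ⟨v, hva, fun s hs hvs => ?_⟩
    by_contra has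
    have hle := hmax s (Finset.mem_filter.2 ⟨hs, has⟩)
    rcases hC s hs t ht.1 with h | h
    · exact hvt (h hvs)
    · exact hvt (Finset.eq_of_subset_of_card_le h hle ▸ hvs)
  · obtain ⟨v, hv⟩ := ha
    refine ⟨v, hv, fun s hs _ => ?_⟩
    by_contra has
    exact h ⟨s, Finset.mem_filter.2 ⟨hs, has⟩⟩

open Classical in
theorem flags_glue (K : SimplicialComplex ℝ E) :
    GlueData K (fun s v => if v ∈ s then (s.card : ℝ)⁻¹ else 0) barycenter (flags K) where
  nonneg := fun s v => by positivity
  carrier := by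
    intro C hC
    obtain ⟨t, ht, hmax⟩ := Finset.exists_max_image C (fun s : Finset E => s.card) hC.1
    refine ⟨t, hC.2.1 t ht, fun s hs => ?_⟩
    have hst : s ⊆ t := by
      rcases hC.2.2 s hs t ht with h | h
      · exact h
      · exact (Finset.eq_of_subset_of_card_le h (hmax s hs)).ge
    have hs0 : (s.card : ℝ) ≠ 0 := by
      have := K.nonempty_of_mem_faces (hC.2.1 s hs)
      exact_mod_cast this.card_pos.ne'
    refine ⟨fun v hv => if_neg fun h => hv (hst h), ?_, ?_⟩
    · rw [Finset.sum_ite_mem, Finset.inter_eq_right.2 hst, Finset.sum_const, nsmul_eq_mul,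
        mul_inv_cancel₀ hs0]
    · simp only [ite_smul, zero_smul]
      rw [Finset.sum_ite_mem, Finset.inter_eq_right.2 hst, barycenter, Finset.smul_sum]
  unique := by
    intro C hC C' hC' m m' hm hm' hmC hmC' h
    have up : ∀ (D : Finset (Finset E)) (n : Finset E → ℝ), (∀ s ∈ D, ∀ t ∈ D, s ⊆ t ∨ t ⊆ s) →
        (∀ s, 0 ≤ n s) → ∀ a : Finset E, a.Nonempty →
        (∃ v ∈ a, ∑ s ∈ D with a ⊆ s, n s * (s.card : ℝ)⁻¹ =
          ∑ s ∈ D, n s * (if v ∈ s then (s.card : ℝ)⁻¹ else 0)) ∧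
        ∀ v ∈ a, ∑ s ∈ D with a ⊆ s, n s * (s.card : ℝ)⁻¹ ≤
          ∑ s ∈ D, n s * (if v ∈ s then (s.card : ℝ)⁻¹ else 0) := by
      intro D n hD hn a ha
      constructor
      · obtain ⟨v, hva, hv⟩ := flag_point hD ha
        refine ⟨v, hva, ?_⟩
        rw [Finset.sum_filter]
        refine Finset.sum_congr rfl fun s hs => ?_
        by_cases hvs : v ∈ s
        · rw [if_pos (hv s hs hvs), if_pos hvs]
        · rw [if_neg fun h => hvs (h hva), if_neg hvs, mul_zero]
      · intro v hva
        rw [Finset.sum_filter]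
        refine Finset.sum_le_sum fun s hs => ?_
        have := mul_nonneg (hn s) (inv_nonneg.2 (Nat.cast_nonneg (α := ℝ) s.card))
        by_cases has : a ⊆ s
        · rw [if_pos has, if_pos (has hva)]
        · rw [if_neg has]
          split_ifs
          · exact this
          · rw [mul_zero]
    have upeq : ∀ a : Finset E, a.Nonempty → ∑ s ∈ C with a ⊆ s, m s * (s.card : ℝ)⁻¹ =
        ∑ s ∈ C' with a ⊆ s, m' s * (s.card : ℝ)⁻¹ := by
      intro a ha
      obtain ⟨⟨v, hv, e⟩, b⟩ := up C m hC.2.2 hm a ha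
      obtain ⟨⟨v', hv', e'⟩, b'⟩ := up C' m' hC'.2.2 hm' a ha
      refine le_antisymm ?_ ?_
      · rw [e', ← h v']; exact b v' hv'
      · rw [e, h v]; exact b' v hv
    have hne : ∀ s ∈ C ∪ C', s.Nonempty := by
      intro s hs
      rcases Finset.mem_union.1 hs with hs | hs
      · exact K.nonempty_of_mem_faces (hC.2.1 s hs)
      · exact K.nonempty_of_mem_faces (hC'.2.1 s hs)
    have fin := eq_of_sums_eq (C ∪ C') (fun a s => a ⊆ s) (fun s => -(s.card : ℤ))
      (fun _ _ => Finset.Subset.refl _)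
      (fun a _ s _ has hne => by
        have := Finset.card_lt_card (Finset.ssubset_iff_subset_ne.2 ⟨has, hne⟩)
        omega)
      (fun s => m s * (s.card : ℝ)⁻¹) (fun s => m' s * (s.card : ℝ)⁻¹) (by
        intro a ha
        have e1 : ∑ s ∈ C ∪ C' with a ⊆ s, m s * (s.card : ℝ)⁻¹ =
            ∑ s ∈ C with a ⊆ s, m s * (s.card : ℝ)⁻¹ := by
          symm
          refine Finset.sum_subset (Finset.filter_subset_filter _ Finset.subset_union_left) ?_
          intro s hs hs'
          rw [hmC s, zero_mul]
          intro hsC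
          exact hs' (Finset.mem_filter.2 ⟨hsC, (Finset.mem_filter.1 hs).2⟩)
        have e2 : ∑ s ∈ C ∪ C' with a ⊆ s, m' s * (s.card : ℝ)⁻¹ =
            ∑ s ∈ C' with a ⊆ s, m' s * (s.card : ℝ)⁻¹ := by
          symm
          refine Finset.sum_subset (Finset.filter_subset_filter _ Finset.subset_union_right) ?_
          intro s hs hs'
          rw [hmC' s, zero_mul]
          intro hsC
          exact hs' (Finset.mem_filter.2 ⟨hsC, (Finset.mem_filter.1 hs).2⟩)
        rw [e1, e2]
        exact upeq a (hne a ha))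
    funext s
    by_cases hs : s ∈ C ∪ C'
    · have hs0 : (s.card : ℝ) ≠ 0 := by exact_mod_cast (hne s hs).card_pos.ne'
      exact mul_right_cancel₀ (inv_ne_zero hs0) (fin s hs)
    · rw [Finset.mem_union, not_or] at hs
      rw [hmC s hs.1, hmC' s hs.2]

theorem exists_sub_image {I : Type*} {pos : I → E} {T : Finset I} {t u : Finset E}
    (ht : (t : Set E) = pos '' T) (hu : u ⊆ t) (hne : u.Nonempty) :
    ∃ T' ⊆ T, T'.Nonempty ∧ (u : Set E) = pos '' T' := by
  classical
  refine ⟨T.filter fun i => pos i ∈ u, Finset.filter_subset _ _, ?_, ?_⟩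
  · obtain ⟨x, hx⟩ := hne
    have : x ∈ (t : Set E) := hu hx
    rw [ht] at this
    obtain ⟨i, hi, rfl⟩ := this
    exact ⟨i, Finset.mem_filter.2 ⟨hi, hx⟩⟩
  · ext x
    constructor
    · intro hx
      have : x ∈ (t : Set E) := hu hx
      rw [ht] at this
      obtain ⟨i, hi, rfl⟩ := this
      exact ⟨i, Finset.mem_coe.2 (Finset.mem_filter.2 ⟨hi, hx⟩), rfl⟩
    · rintro ⟨i, hi, rfl⟩
      exact (Finset.mem_filter.1 hi).2

theorem nonempty_of_image {I : Type*} {pos : I → E} {T : Finset I} {t : Finset E}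
    (ht : (t : Set E) = pos '' T) (hT : T.Nonempty) : t.Nonempty := by
  rw [← Finset.coe_nonempty, ht]
  exact (Finset.coe_nonempty.2 hT).image _

/-- The barycentric subdivision of a geometric simplicial complex: its simplices are spanned by the
barycenters of the members of the flags of `K`. -/
noncomputable def barycentricSubdivision (K : SimplicialComplex ℝ E) : SimplicialComplex ℝ E where
  faces := {t | ∃ C ∈ flags K, (t : Set E) = barycenter '' C}
  isRelLowerSet_faces := by
    rintro t ⟨C, hC, ht⟩
    refine ⟨nonempty_of_image ht hC.1, fun u hu hne => ?_⟩
    obtain ⟨C', hC', hn, hu'⟩ := exists_sub_image ht hu hne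
    exact ⟨C', ⟨hn, fun s hs => hC.2.1 s (hC' hs),
      fun s hs s' hs' => hC.2.2 s (hC' hs) s' (hC' hs')⟩, hu'⟩
  indep := by
    rintro t ⟨C, hC, ht⟩
    exact (flags_glue K).indep_image hC ht
  inter_subset_convexHull := by
    rintro t t' ⟨C, hC, ht⟩ ⟨C', hC', ht'⟩
    exact (flags_glue K).inter hC hC' ht ht'

/-! ### Edgewise subdivision -/

/-- A geometric simplicial complex with a relation on its vertices that is a total order on the
vertices of each simplex. (In particular, any total order on the set of all vertices will do.) -/
structure OrderedComplex (E : Type*) [AddCommGroup E] [Module ℝ E] where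
  complex : SimplicialComplex ℝ E
  le : E → E → Prop
  total : ∀ s ∈ complex.faces, ∀ a ∈ s, ∀ b ∈ s, le a b ∨ le b a
  antisymm : ∀ s ∈ complex.faces, ∀ a ∈ s, ∀ b ∈ s, le a b → le b a → a = b
  trans : ∀ s ∈ complex.faces, ∀ a ∈ s, ∀ b ∈ s, ∀ c ∈ s, le a b → le b c → le a c

/-- Componentwise order on pairs of vertices. -/
def OrderedComplex.pairLE (K : OrderedComplex E) (p q : E × E) : Prop :=
  K.le p.1 q.1 ∧ K.le p.2 q.2

/-- Two-row colour schemes. Written as columns `(a₀, b₀), …, (aₖ, bₖ)`, such a scheme has all its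
entries in one simplex of `K` and satisfies `a₀ ≤ … ≤ aₖ ≤ b₀ ≤ … ≤ bₖ`. -/
def OrderedComplex.schemes (K : OrderedComplex E) : Set (Finset (E × E)) :=
  {P | P.Nonempty ∧ (∃ s ∈ K.complex.faces, ∀ p ∈ P, p.1 ∈ s ∧ p.2 ∈ s) ∧
    ∀ p ∈ P, ∀ q ∈ P, K.le p.1 q.2 ∧ (K.pairLE p q ∨ K.pairLE q p)}

open Classical in
theorem scheme_sums {s : Finset E} {le : E → E → Prop} (P : Finset (E × E))
    (hP : ∀ p ∈ P, p.1 ∈ s ∧ p.2 ∈ s)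
    (trans : ∀ a ∈ s, ∀ b ∈ s, ∀ c ∈ s, le a b → le b c → le a c)
    (h1 : ∀ p ∈ P, ∀ q ∈ P, le p.1 q.2)
    (h2 : ∀ p ∈ P, ∀ q ∈ P, (le p.1 q.1 ∧ le p.2 q.2) ∨ (le q.1 p.1 ∧ le q.2 p.2))
    (m : E × E → ℝ) (hm : ∀ p, 0 ≤ m p) (lam : E → ℝ)
    (hlam : ∀ v, lam v = ∑ p ∈ P, m p * ((if p.1 = v then 1 / 2 else 0) +
      (if p.2 = v then 1 / 2 else 0))) {u v : E} (hu : u ∈ s) (hv : v ∈ s) :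
    ∑ p ∈ P with le p.1 u ∧ le p.2 v, m p =
      min (min (∑ w ∈ s, lam w) (∑ w ∈ s with le w u, 2 * lam w))
        (∑ w ∈ s with le w v, 2 * lam w -
          min (∑ w ∈ s, lam w) (∑ w ∈ s with le w v, 2 * lam w)) := by
  have tot : ∑ w ∈ s, lam w = ∑ p ∈ P, m p := by
    simp only [hlam]
    rw [Finset.sum_comm]
    refine Finset.sum_congr rfl fun p hp => ?_
    rw [← Finset.mul_sum, Finset.sum_add_distrib, Finset.sum_ite_eq, Finset.sum_ite_eq,
      if_pos (hP p hp).1, if_pos (hP p hp).2]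
    ring
  have cum : ∀ u, ∑ w ∈ s with le w u, 2 * lam w =
      ∑ p ∈ P with le p.1 u, m p + ∑ p ∈ P with le p.2 u, m p := by
    intro u
    simp only [hlam, Finset.mul_sum]
    rw [Finset.sum_comm, Finset.sum_filter, Finset.sum_filter, ← Finset.sum_add_distrib]
    refine Finset.sum_congr rfl fun p hp => ?_
    rw [← Finset.mul_sum, ← Finset.mul_sum, Finset.sum_add_distrib, Finset.sum_ite_eq,
      Finset.sum_ite_eq]
    simp only [Finset.mem_filter, (hP p hp).1, (hP p hp).2, true_and]
    split_ifs <;> ring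
  have sub_le : ∀ (Q R : E × E → Prop), (∀ p ∈ P, Q p → R p) →
      ∑ p ∈ P with Q p, m p ≤ ∑ p ∈ P with R p, m p := by
    intro Q R hQR
    refine Finset.sum_le_sum_of_subset_of_nonneg ?_ fun p _ _ => hm p
    intro p hp
    rw [Finset.mem_filter] at hp ⊢
    exact ⟨hp.1, hQR p hp.1 hp.2⟩
  have low : ∀ u ∈ s, min (∑ w ∈ s, lam w) (∑ w ∈ s with le w u, 2 * lam w) =
      ∑ p ∈ P with le p.1 u, m p := by
    intro u hu
    rw [tot, cum]
    have hB : 0 ≤ ∑ p ∈ P with le p.2 u, m p := Finset.sum_nonneg fun p _ => hm p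
    have hA : ∑ p ∈ P with le p.1 u, m p ≤ ∑ p ∈ P, m p := by
      simpa using sub_le (fun p => le p.1 u) (fun _ => True) (fun _ _ _ => trivial)
    by_cases hq : ∃ q ∈ P, le q.2 u
    · obtain ⟨q, hq, hqu⟩ := hq
      have : ∑ p ∈ P with le p.1 u, m p = ∑ p ∈ P, m p := by
        rw [Finset.filter_true_of_mem]
        intro p hp
        exact trans _ (hP p hp).1 _ (hP q hq).2 _ hu (h1 p hp q hq) hqu
      rw [this, min_eq_left (by linarith)]
    · have : ∑ p ∈ P with le p.2 u, m p = 0 := by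
        rw [Finset.filter_false_of_mem, Finset.sum_empty]
        intro p hp h
        exact hq ⟨p, hp, h⟩
      rw [this, add_zero, min_eq_right hA]
  rw [low u hu, low v hv, cum v, add_sub_cancel_left]
  have a1 := sub_le (fun p => le p.1 u ∧ le p.2 v) (fun p => le p.1 u) (fun _ _ h => h.1)
  have a2 := sub_le (fun p => le p.1 u ∧ le p.2 v) (fun p => le p.2 v) (fun _ _ h => h.2)
  by_cases hp : ∃ p ∈ P, le p.1 u ∧ ¬ le p.2 v
  · obtain ⟨p, hp, hpu, hpv⟩ := hp
    have := sub_le (fun p => le p.2 v) (fun p => le p.1 u ∧ le p.2 v) (by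
      intro q hq hqv
      refine ⟨?_, hqv⟩
      rcases h2 p hp q hq with h | h
      · exact absurd (trans _ (hP p hp).2 _ (hP q hq).2 _ hv h.2 hqv) hpv
      · exact trans _ (hP q hq).1 _ (hP p hp).1 _ hu h.1 hpu)
    rw [min_eq_right (by convert! this.trans a1)]
    exact le_antisymm (by convert! a2) (by convert! this)
  · push Not at hp
    have := sub_le (fun p => le p.1 u) (fun p => le p.1 u ∧ le p.2 v)
      (fun q hq hqu => ⟨hqu, hp q hq hqu⟩)
    rw [min_eq_left (by convert! this.trans a2)]
    exact le_antisymm (by convert! a1) (by convert! this)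

open Classical in
theorem scheme_unique {s : Finset E} {le : E → E → Prop} (P Q : Finset (E × E))
    (total : ∀ a ∈ s, ∀ b ∈ s, le a b ∨ le b a)
    (antisymm : ∀ a ∈ s, ∀ b ∈ s, le a b → le b a → a = b)
    (trans : ∀ a ∈ s, ∀ b ∈ s, ∀ c ∈ s, le a b → le b c → le a c)
    (hP : ∀ p ∈ P, p.1 ∈ s ∧ p.2 ∈ s) (hQ : ∀ p ∈ Q, p.1 ∈ s ∧ p.2 ∈ s)
    (hP1 : ∀ p ∈ P, ∀ q ∈ P, le p.1 q.2) (hQ1 : ∀ p ∈ Q, ∀ q ∈ Q, le p.1 q.2)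
    (hP2 : ∀ p ∈ P, ∀ q ∈ P, (le p.1 q.1 ∧ le p.2 q.2) ∨ (le q.1 p.1 ∧ le q.2 p.2))
    (hQ2 : ∀ p ∈ Q, ∀ q ∈ Q, (le p.1 q.1 ∧ le p.2 q.2) ∨ (le q.1 p.1 ∧ le q.2 p.2))
    (m n : E × E → ℝ) (hm : ∀ p, 0 ≤ m p) (hn : ∀ p, 0 ≤ n p)
    (hmP : ∀ p ∉ P, m p = 0) (hnQ : ∀ p ∉ Q, n p = 0)
    (h : ∀ v, ∑ p ∈ P, m p * ((if p.1 = v then 1 / 2 else 0) + (if p.2 = v then 1 / 2 else 0)) =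
      ∑ p ∈ Q, n p * ((if p.1 = v then 1 / 2 else 0) + (if p.2 = v then 1 / 2 else 0))) :
    m = n := by
  have hPQ : ∀ p ∈ P ∪ Q, p.1 ∈ s ∧ p.2 ∈ s := by
    intro p hp
    rcases Finset.mem_union.1 hp with hp | hp
    · exact hP p hp
    · exact hQ p hp
  set rk : E → ℤ := fun v => ((s.filter fun w => le w v).card : ℤ) with hrk
  have refl : ∀ a ∈ s, le a a := fun a ha => (total a ha a ha).elim id id
  have rk_le : ∀ a ∈ s, ∀ b ∈ s, le a b → rk a ≤ rk b := by
    intro a ha b hb hab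
    have : (s.filter fun w => le w a) ⊆ s.filter fun w => le w b := by
      intro w hw
      rw [Finset.mem_filter] at hw ⊢
      exact ⟨hw.1, trans w hw.1 a ha b hb hw.2 hab⟩
    exact Int.ofNat_le.2 (Finset.card_le_card this)
  have rk_lt : ∀ a ∈ s, ∀ b ∈ s, le a b → a ≠ b → rk a < rk b := by
    intro a ha b hb hab hne
    have : (s.filter fun w => le w a) ⊂ s.filter fun w => le w b := by
      rw [Finset.ssubset_iff_of_subset]
      · refine ⟨b, Finset.mem_filter.2 ⟨hb, refl b hb⟩, fun h => hne ?_⟩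
        exact antisymm a ha b hb hab (Finset.mem_filter.1 h).2
      · intro w hw
        rw [Finset.mem_filter] at hw ⊢
        exact ⟨hw.1, trans w hw.1 a ha b hb hw.2 hab⟩
    exact Int.ofNat_lt.2 (Finset.card_lt_card this)
  have fin := eq_of_sums_eq (P ∪ Q) (fun p q => le q.1 p.1 ∧ le q.2 p.2)
    (fun p => rk p.1 + rk p.2)
    (fun p hp => ⟨refl _ (hPQ p hp).1, refl _ (hPQ p hp).2⟩)
    (by
      intro p hp q hq hqp hne
      have a1 := rk_le _ (hPQ q hq).1 _ (hPQ p hp).1 hqp.1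
      have a2 := rk_le _ (hPQ q hq).2 _ (hPQ p hp).2 hqp.2
      by_cases e : q.1 = p.1
      · have e2 : q.2 ≠ p.2 := fun e2 => hne (Prod.ext e.symm e2.symm)
        have := rk_lt _ (hPQ q hq).2 _ (hPQ p hp).2 hqp.2 e2
        omega
      · have := rk_lt _ (hPQ q hq).1 _ (hPQ p hp).1 hqp.1 e
        omega) m n (by
      intro p hp
      have e1 : ∑ q ∈ P ∪ Q with le q.1 p.1 ∧ le q.2 p.2, m q =
          ∑ q ∈ P with le q.1 p.1 ∧ le q.2 p.2, m q := by
        symm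
        refine Finset.sum_subset (Finset.filter_subset_filter _ Finset.subset_union_left) ?_
        intro q hq hq'
        exact hmP q fun hqP => hq' (Finset.mem_filter.2 ⟨hqP, (Finset.mem_filter.1 hq).2⟩)
      have e2 : ∑ q ∈ P ∪ Q with le q.1 p.1 ∧ le q.2 p.2, n q =
          ∑ q ∈ Q with le q.1 p.1 ∧ le q.2 p.2, n q := by
        symm
        refine Finset.sum_subset (Finset.filter_subset_filter _ Finset.subset_union_right) ?_
        intro q hq hq'
        exact hnQ q fun hqP => hq' (Finset.mem_filter.2 ⟨hqP, (Finset.mem_filter.1 hq).2⟩)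
      rw [e1, e2, scheme_sums P hP trans hP1 hP2 m hm _ (fun _ => rfl) (hPQ p hp).1 (hPQ p hp).2,
        scheme_sums Q hQ trans hQ1 hQ2 n hn _ h (hPQ p hp).1 (hPQ p hp).2])
  funext p
  by_cases hp : p ∈ P ∪ Q
  · exact fin p hp
  · rw [Finset.mem_union, not_or] at hp
    rw [hmP p hp.1, hnQ p hp.2]

open Classical in
theorem schemes_glue (K : OrderedComplex E) :
    GlueData K.complex (fun (p : E × E) v => (if p.1 = v then 1 / 2 else 0) +
      (if p.2 = v then 1 / 2 else 0)) (fun p => midpoint ℝ p.1 p.2) K.schemes where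
  nonneg := fun p v => by positivity
  carrier := by
    rintro P ⟨-, ⟨s, hs, hPs⟩, -⟩
    refine ⟨s, hs, fun p hp => ⟨fun v hv => ?_, ?_, ?_⟩⟩
    · rw [if_neg (by rintro rfl; exact hv (hPs p hp).1),
        if_neg (by rintro rfl; exact hv (hPs p hp).2), add_zero]
    · rw [Finset.sum_add_distrib, Finset.sum_ite_eq, Finset.sum_ite_eq, if_pos (hPs p hp).1,
        if_pos (hPs p hp).2]
      norm_num
    · simp only [add_smul, ite_smul, zero_smul]
      rw [Finset.sum_add_distrib, Finset.sum_ite_eq, Finset.sum_ite_eq, if_pos (hPs p hp).1,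
        if_pos (hPs p hp).2, midpoint_eq_smul_add, smul_add, invOf_eq_inv, one_div]
  unique := by
    rintro P ⟨-, ⟨s, hs, hPs⟩, hP⟩ Q ⟨-, -, hQ⟩ m n hm hn hmP hnQ h
    have hsub : Q.filter (fun q => n q ≠ 0) ⊆ Q := Finset.filter_subset _ _
    have pos_of : ∀ q ∈ Q.filter (fun q => n q ≠ 0), ∀ v, (q.1 = v ∨ q.2 = v) → v ∈ s := by
      intro q hq v hqv
      by_contra hvs
      have z : ∑ p ∈ P, m p * ((if p.1 = v then 1 / 2 else 0) + (if p.2 = v then 1 / 2 else 0))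
          = 0 := by
        refine Finset.sum_eq_zero fun p hp => ?_
        rw [if_neg (by rintro rfl; exact hvs (hPs p hp).1),
          if_neg (by rintro rfl; exact hvs (hPs p hp).2),
          add_zero, mul_zero]
      rw [h v] at z
      rw [Finset.mem_filter] at hq
      have z' := (Finset.sum_eq_zero_iff_of_nonneg (fun p _ =>
        mul_nonneg (hn p) (by positivity))).1 z q hq.1
      rcases mul_eq_zero.1 z' with z' | z'
      · exact hq.2 z'
      · have b1 : (0 : ℝ) ≤ if q.1 = v then 1 / 2 else 0 := by positivity
        have b2 : (0 : ℝ) ≤ if q.2 = v then 1 / 2 else 0 := by positivity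
        rcases hqv with e | e
        · rw [if_pos e] at z'; linarith
        · rw [if_pos e] at z'; linarith
    refine scheme_unique P (Q.filter fun q => n q ≠ 0) (K.total s hs) (K.antisymm s hs)
      (K.trans s hs) hPs (fun q hq => ⟨pos_of q hq _ (Or.inl rfl), pos_of q hq _ (Or.inr rfl)⟩)
      (fun p hp q hq => (hP p hp q hq).1) (fun p hp q hq => (hQ p (hsub hp) q (hsub hq)).1)
      (fun p hp q hq => (hP p hp q hq).2) (fun p hp q hq => (hQ p (hsub hp) q (hsub hq)).2)
      m n hm hn hmP ?_ ?_
    · intro q hq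
      by_cases hqQ : q ∈ Q
      · by_contra hne
        exact hq (Finset.mem_filter.2 ⟨hqQ, hne⟩)
      · exact hnQ q hqQ
    · intro v
      rw [h v]
      symm
      refine Finset.sum_subset hsub fun q hq hq' => ?_
      have : n q = 0 := by
        by_contra hne
        exact hq' (Finset.mem_filter.2 ⟨hq, hne⟩)
      rw [this, zero_mul]

theorem OrderedComplex.schemes_mono (K : OrderedComplex E) {P Q : Finset (E × E)}
    (hP : P ∈ K.schemes) (hQ : Q ⊆ P) (hne : Q.Nonempty) : Q ∈ K.schemes := by
  obtain ⟨-, ⟨s, hs, h⟩, h'⟩ := hP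
  exact ⟨hne, ⟨s, hs, fun p hp => h p (hQ hp)⟩, fun p hp q hq => h' p (hQ hp) q (hQ hq)⟩

/-- The order induced on the vertices of the edgewise subdivision: columns of a common scheme are
compared componentwise. -/
def OrderedComplex.midpointLE (K : OrderedComplex E) (x y : E) : Prop :=
  ∃ P ∈ K.schemes, ∃ p ∈ P, ∃ q ∈ P, K.pairLE p q ∧ x = midpoint ℝ p.1 p.2 ∧
    y = midpoint ℝ q.1 q.2

theorem OrderedComplex.midpointLE_iff (K : OrderedComplex E) {P : Finset (E × E)}
    (hP : P ∈ K.schemes) {p q : E × E} (hp : p ∈ P) (hq : q ∈ P) :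
    K.midpointLE (midpoint ℝ p.1 p.2) (midpoint ℝ q.1 q.2) ↔ K.pairLE p q := by
  constructor
  · rintro ⟨P', hP', p', hp', q', hq', h, e1, e2⟩
    have i1 := (schemes_glue K).pos_inj hP hP' hp hp' e1
    have i2 := (schemes_glue K).pos_inj hP hP' hq hq' e2
    rw [i1, i2]
    exact h
  · intro h
    exact ⟨P, hP, p, hp, q, hq, h, rfl, rfl⟩

/-- The edgewise subdivision of an ordered geometric simplicial complex: each scheme
`a₀ ≤ … ≤ aₖ ≤ b₀ ≤ … ≤ bₖ` gives the simplex spanned by the midpoints of the `[aᵢ, bᵢ]`,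
whose vertices are ordered in the same way as the columns. -/
noncomputable def edgewiseSubdivision (K : OrderedComplex E) : OrderedComplex E where
  complex :=
    { faces := {t | ∃ P ∈ K.schemes, (t : Set E) = (fun p : E × E => midpoint ℝ p.1 p.2) '' P}
      isRelLowerSet_faces := by
        rintro t ⟨P, hP, ht⟩
        refine ⟨nonempty_of_image ht hP.1, fun u hu hne => ?_⟩
        obtain ⟨Q, hQ, hn, hu'⟩ := exists_sub_image ht hu hne
        exact ⟨Q, K.schemes_mono hP hQ hn, hu'⟩
      indep := by
        rintro t ⟨P, hP, ht⟩
        exact (schemes_glue K).indep_image hP ht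
      inter_subset_convexHull := by
        rintro t t' ⟨P, hP, ht⟩ ⟨P', hP', ht'⟩
        exact (schemes_glue K).inter hP hP' ht ht' }
  le := K.midpointLE
  total := by
    rintro t ⟨P, hP, ht⟩ x hx y hy
    rw [← Finset.mem_coe, ht] at hx hy
    obtain ⟨p, hp, rfl⟩ := hx
    obtain ⟨q, hq, rfl⟩ := hy
    exact (hP.2.2 p hp q hq).2.imp (K.midpointLE_iff hP hp hq).2 (K.midpointLE_iff hP hq hp).2
  antisymm := by
    rintro t ⟨P, hP, ht⟩ x hx y hy hxy hyx
    rw [← Finset.mem_coe, ht] at hx hy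
    obtain ⟨p, hp, rfl⟩ := hx
    obtain ⟨q, hq, rfl⟩ := hy
    have h1 := (K.midpointLE_iff hP hp hq).1 hxy
    have h2 := (K.midpointLE_iff hP hq hp).1 hyx
    obtain ⟨s, hs, hPs⟩ := hP.2.1
    have e1 := K.antisymm s hs _ (hPs p hp).1 _ (hPs q hq).1 h1.1 h2.1
    have e2 := K.antisymm s hs _ (hPs p hp).2 _ (hPs q hq).2 h1.2 h2.2
    simp only [e1, e2]
  trans := by
    rintro t ⟨P, hP, ht⟩ x hx y hy z hz hxy hyz
    rw [← Finset.mem_coe, ht] at hx hy hz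
    obtain ⟨p, hp, rfl⟩ := hx
    obtain ⟨q, hq, rfl⟩ := hy
    obtain ⟨r, hr, rfl⟩ := hz
    have h1 := (K.midpointLE_iff hP hp hq).1 hxy
    have h2 := (K.midpointLE_iff hP hq hr).1 hyz
    obtain ⟨s, hs, hPs⟩ := hP.2.1
    exact (K.midpointLE_iff hP hp hr).2
      ⟨K.trans s hs _ (hPs p hp).1 _ (hPs q hq).1 _ (hPs r hr).1 h1.1 h2.1,
        K.trans s hs _ (hPs p hp).2 _ (hPs q hq).2 _ (hPs r hr).2 h1.2 h2.2⟩

/-! ### Stars, the two star conditions, weak simplicial approximations -/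

/-- The open simplex spanned by `s`; if `s` is a single point, it is that point. -/
def openSimplex (s : Finset E) : Set E :=
  {x | ∃ w : E → ℝ, (∀ v ∈ s, 0 < w v) ∧ ∑ v ∈ s, w v = 1 ∧ ∑ v ∈ s, w v • v = x}

/-- The realization of the open star of the vertex `w`. -/
def openStar (L : SimplicialComplex ℝ E) (w : E) : Set E :=
  ⋃ s ∈ {s | s ∈ L.faces ∧ w ∈ s}, openSimplex s

/-- The simplices of the closed star of the vertex `v`. -/
def closedStar (K : SimplicialComplex ℝ E) (v : E) : Set (Finset E) :=
  {t | t ∈ K.faces ∧ ∃ s ∈ K.faces, v ∈ s ∧ t ⊆ s}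

/-- The realization of the closed star. -/
def closedStarSpace (K : SimplicialComplex ℝ E) (v : E) : Set E :=
  ⋃ t ∈ closedStar K v, convexHull ℝ (t : Set E)

/-- The vertices of the closed star of `v`: the neighbours of `v`, and `v` itself. -/
def closedStarVertices (K : SimplicialComplex ℝ E) (v : E) : Set E :=
  {u | {u} ∈ closedStar K v}

/-- The star condition for `f : |K| → |L|`. -/
def StarCondition (f : E → F) (K : SimplicialComplex ℝ E) (L : SimplicialComplex ℝ F) : Prop :=
  ∀ v ∈ K.vertices, ∃ w ∈ L.vertices, f '' closedStarSpace K v ⊆ openStar L w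

/-- The weak star condition for `f : |K| → |L|`. -/
def WeakStarCondition (f : E → F) (K : SimplicialComplex ℝ E) (L : SimplicialComplex ℝ F) : Prop :=
  ∀ v ∈ K.vertices, ∃ w ∈ L.vertices, f '' closedStarVertices K v ⊆ openStar L w

/-- `g` is a weak simplicial approximation to `f : |K| → |L|`. -/
def IsWeakSimplicialApproximation (f : E → F) (K : SimplicialComplex ℝ E)
    (L : SimplicialComplex ℝ F) (g : K.vertices → L.vertices) : Prop :=
  ∀ v : K.vertices, f '' closedStarVertices K v ⊆ openStar L (g v)

/-- `K i` is the content of the variable `K` after `i` passes through the body of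
`while (test fails) { K := Sub K }; let g be a weak simplicial approximation; return g`.
The loop is left after finitely many passes, namely as soon as the test succeeds, and then a weak
simplicial approximation is available to be returned. -/
def Terminates (f : E → F) (K : ℕ → SimplicialComplex ℝ E) (L : SimplicialComplex ℝ F)
    (test : (E → F) → SimplicialComplex ℝ E → SimplicialComplex ℝ F → Prop) : Prop :=
  ∃ n : ℕ, (∀ i < n, ¬ test f (K i) L) ∧ test f (K n) L ∧
    ∃ g : (K n).vertices → L.vertices, IsWeakSimplicialApproximation f (K n) L g

end SimplicialApprox

/-! Everything reduces to the star condition, the stronger of the two tests: once it holds at some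
stage, each loop stops at the least index where its test succeeds, and choosing a star for each
vertex gives the weak simplicial approximation.

The star condition holds on every complex inside `|K|` with short enough edges
(`exists_forall_starCondition`). Off the antistar of `w`, a point of `|L|` lies in the open star of
`w`. Antistars are closed because `L` is finite, and no point of `|L|` lies in all of them, so the
preimages of their complements form an open cover of the compact space `|K|`. A closed star lies in
a ball around its vertex whose radius is the mesh; once the mesh is below a Lebesgue number of the
cover, the star maps into a single open star.

It remains to see that the mesh tends to `0`. Barycentric subdivision multiplies it by at most `d /
(d + 1)`, where `d` is the dimension of the ambient space. For edgewise subdivision, edge lengths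
need not halve in one step; what halves is the variation of affine functions that are monotone for
the vertex order (`monotoneWithin_midpointLE`). Every barycentric coordinate of an original simplex
is a difference of two such functions, so after `i` steps the coordinates vary by at most `1 / 2 ^
i` along an edge, and finitely many original simplices turn this into a uniform bound on lengths. -/

namespace SimplicialApprox

open Geometry Set Finset

/-! ### Carriers of points and antistars -/

section Weights

variable {E : Type*} [AddCommGroup E] [Module ℝ E]

/-- Every point of a simplex lies in the open simplex spanned by one of its faces. -/
theorem exists_openSimplex {s : Finset E} {x : E} (hx : x ∈ convexHull ℝ (s : Set E)) :
    ∃ t ⊆ s, t.Nonempty ∧ x ∈ openSimplex t := by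
  classical
  obtain ⟨w, hw0, hw1, hw2⟩ := Finset.mem_convexHull'.1 hx
  have hz : ∀ v ∈ s, v ∉ s.filter (fun v => w v ≠ 0) → w v = 0 := by
    intro v hv hv'
    by_contra h
    exact hv' (Finset.mem_filter.2 ⟨hv, h⟩)
  have h1 : ∑ v ∈ s with w v ≠ 0, w v = 1 := by
    rw [Finset.sum_subset (Finset.filter_subset _ _) hz, hw1]
  refine ⟨s.filter fun v => w v ≠ 0, Finset.filter_subset _ _, ?_, w, ?_, h1, ?_⟩
  · by_contra h
    rw [Finset.not_nonempty_iff_eq_empty] at h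
    rw [h, Finset.sum_empty] at h1
    exact zero_ne_one h1
  · intro v hv
    rw [Finset.mem_filter] at hv
    exact (hw0 v hv.1).lt_of_ne' hv.2
  · rw [Finset.sum_subset (Finset.filter_subset _ _) fun v hv hv' => by rw [hz v hv hv', zero_smul],
      hw2]

/-- The carrier of a point is contained in every simplex that contains the point. -/
theorem subset_of_mem_openSimplex {L : SimplicialComplex ℝ E} {s t : Finset E} (hs : s ∈ L.faces)
    (ht : t ∈ L.faces) {x : E} (hx : x ∈ openSimplex s) (hxt : x ∈ convexHull ℝ (t : Set E)) :
    s ⊆ t := by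
  classical
  obtain ⟨w, hw0, hw1, hw2⟩ := hx
  obtain ⟨z, hz0, hz1, hz2⟩ := Finset.mem_convexHull'.1 hxt
  intro v hv
  by_contra hvt
  -- Both weight functions are extended by zero so that they can be compared on all of `E`; at `v`
  -- they would be positive and zero.
  have e := coord_unique_complex L hs ht (x := fun v => if v ∈ s then w v else 0)
    (y := fun v => if v ∈ t then z v else 0)
    (fun v => by split_ifs with h; exacts [(hw0 v h).le, le_rfl])
    (fun v => by split_ifs with h; exacts [hz0 v h, le_rfl])
    (fun v hv => if_neg hv) (fun v hv => if_neg hv)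
    (by rw [← hw1]; exact Finset.sum_congr rfl fun v hv => if_pos hv)
    (by rw [← hz1]; exact Finset.sum_congr rfl fun v hv => if_pos hv)
    (by
      rw [Finset.sum_congr rfl fun v hv => by rw [if_pos hv],
        Finset.sum_congr (s₁ := t) rfl fun v hv => by rw [if_pos hv], hw2, hz2])
  have := congrFun e v
  simp only [if_pos hv, if_neg hvt] at this
  exact (hw0 v hv).ne' this

/-- The union of the simplices of `L` that do not contain `w`. -/
def antistar (L : SimplicialComplex ℝ E) (w : E) : Set E :=
  ⋃ t ∈ {t | t ∈ L.faces ∧ w ∉ t}, convexHull ℝ (t : Set E)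

/-- The carrier of `x` is a simplex containing `x`, so it must have `w` as a vertex; otherwise it
would put `x` in the antistar. -/
theorem mem_openStar_of_notMem_antistar {L : SimplicialComplex ℝ E} {x w : E} (hx : x ∈ L.space)
    (hxw : x ∉ antistar L w) : x ∈ openStar L w := by
  obtain ⟨s, hs, hxs⟩ := SimplicialComplex.mem_space_iff.1 hx
  obtain ⟨t, hts, htn, hxt⟩ := exists_openSimplex hxs
  have ht := L.down_closed hs hts htn
  refine mem_biUnion (x := t) ⟨ht, ?_⟩ hxt
  by_contra hwt
  obtain ⟨z, hz0, hz1, hz2⟩ := hxt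
  exact hxw (mem_biUnion (x := t) ⟨ht, hwt⟩
    (Finset.mem_convexHull'.2 ⟨z, fun v hv => (hz0 v hv).le, hz1, hz2⟩))

/-- Any vertex of the carrier of `x` works, since every simplex containing `x` contains the carrier.
This makes the complements of the antistars cover `|L|`. -/
theorem exists_notMem_antistar {L : SimplicialComplex ℝ E} {x : E} (hx : x ∈ L.space) :
    ∃ w ∈ L.vertices, x ∉ antistar L w := by
  obtain ⟨s, hs, hxs⟩ := SimplicialComplex.mem_space_iff.1 hx
  obtain ⟨t, hts, ⟨w, hw⟩, hxt⟩ := exists_openSimplex hxs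
  have ht := L.down_closed hs hts ⟨w, hw⟩
  refine ⟨w, L.down_closed ht (Finset.singleton_subset_iff.2 hw) (Finset.singleton_nonempty w), ?_⟩
  intro h
  obtain ⟨r, ⟨hr, hwr⟩, hxr⟩ := mem_iUnion₂.1 h
  exact hwr (subset_of_mem_openSimplex ht hr hxt hxr hw)

end Weights

/-! ### From the star condition to termination -/

section Termination

variable {E F : Type*} [AddCommGroup E] [Module ℝ E] [AddCommGroup F] [Module ℝ F]
  {f : E → F} {L : SimplicialComplex ℝ F}

theorem StarCondition.weakStarCondition {K : SimplicialComplex ℝ E} (h : StarCondition f K L) :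
    WeakStarCondition f K L := by
  intro v hv
  obtain ⟨w, hw, hvw⟩ := h v hv
  refine ⟨w, hw, (image_mono ?_).trans hvw⟩
  intro u hu
  exact mem_biUnion (x := {u}) hu (by simp)

theorem WeakStarCondition.exists_isWeakSimplicialApproximation {K : SimplicialComplex ℝ E}
    (h : WeakStarCondition f K L) :
    ∃ g : K.vertices → L.vertices, IsWeakSimplicialApproximation f K L g := by
  choose g hg hfg using h
  exact ⟨fun v => ⟨g v v.2, hg v v.2⟩, fun v => hfg v v.2⟩

/-- The loop stops at the least index passing the test. `htest` supplies the returned approximation,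
whichever of the two tests is used. -/
theorem terminates_of_exists {K : ℕ → SimplicialComplex ℝ E}
    {test : (E → F) → SimplicialComplex ℝ E → SimplicialComplex ℝ F → Prop}
    (htest : ∀ K, test f K L → WeakStarCondition f K L) (h : ∃ n, test f (K n) L) :
    Terminates f K L test := by
  classical
  exact ⟨Nat.find h, fun i hi => Nat.find_min h hi, Nat.find_spec h,
    (htest _ (Nat.find_spec h)).exists_isWeakSimplicialApproximation⟩

theorem terminates_of_exists_starCondition {K : ℕ → SimplicialComplex ℝ E}
    (h : ∃ n, StarCondition f (K n) L) :
    Terminates f K L WeakStarCondition ∧ Terminates f K L StarCondition :=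
  ⟨terminates_of_exists (fun _ => id) (h.imp fun _ => StarCondition.weakStarCondition),
    terminates_of_exists (fun _ => StarCondition.weakStarCondition) h⟩

end Termination

/-! ### Fine complexes satisfy the star condition -/

section Mesh

variable {E F : Type*} [NormedAddCommGroup E] [NormedSpace ℝ E]
  [NormedAddCommGroup F] [NormedSpace ℝ F]

/-- All edges of `K` have length at most `δ`. -/
def MeshLE (K : SimplicialComplex ℝ E) (δ : ℝ) : Prop :=
  ∀ s ∈ K.faces, ∀ x ∈ s, ∀ y ∈ s, dist x y ≤ δ

theorem exists_meshLE {K : SimplicialComplex ℝ E} (hK : K.faces.Finite) : ∃ δ, MeshLE K δ := by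
  have hfin : (⋃ s ∈ K.faces, (s : Set E)).Finite := hK.biUnion fun s _ => s.finite_toSet
  obtain ⟨δ, hδ⟩ := Metric.isBounded_iff.1 hfin.isBounded
  exact ⟨δ, fun s hs x hx y hy => hδ (mem_biUnion hs hx) (mem_biUnion hs hy)⟩

theorem isCompact_space {K : SimplicialComplex ℝ E} (hK : K.faces.Finite) : IsCompact K.space :=
  hK.isCompact_biUnion fun s _ => s.finite_toSet.isCompact_convexHull ℝ

/-- A finite union of compact hulls; this is where finiteness of `L` enters. -/
theorem isClosed_antistar {L : SimplicialComplex ℝ F} (hL : L.faces.Finite) (w : F) :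
    IsClosed (antistar L w) :=
  (hL.subset fun _ h => h.1).isClosed_biUnion fun s _ => s.finite_toSet.isClosed_convexHull ℝ

/-- Balls are convex, so it is enough to bound the distance from `v` to the vertices of each simplex
containing `v`. -/
theorem closedStarSpace_subset_closedBall {K : SimplicialComplex ℝ E} {δ : ℝ} (h : MeshLE K δ)
    (v : E) : closedStarSpace K v ⊆ Metric.closedBall v δ := by
  intro x hx
  obtain ⟨t, ⟨-, s, hs, hvs, hts⟩, hxt⟩ := mem_iUnion₂.1 hx
  exact convexHull_min (fun y hy => Metric.mem_closedBall.2 (h s hs y (hts hy) v hvs))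
    (convex_closedBall v δ) hxt

theorem closedStarSpace_subset_space (K : SimplicialComplex ℝ E) (v : E) :
    closedStarSpace K v ⊆ K.space :=
  iUnion₂_subset fun _ ht => SimplicialComplex.convexHull_subset_space ht.1

/-- A continuous map satisfies the star condition on every sufficiently fine complex. -/
theorem exists_forall_starCondition {K : SimplicialComplex ℝ E} {L : SimplicialComplex ℝ F}
    (hK : K.faces.Finite) (hL : L.faces.Finite) {f : E → F} (hf : ContinuousOn f K.space)
    (hfL : MapsTo f K.space L.space) :
    ∃ δ > 0, ∀ K' : SimplicialComplex ℝ E, ∀ ε < δ, K'.space ⊆ K.space → MeshLE K' ε →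
      StarCondition f K' L := by
  -- As `f` is continuous only on `|K|`, the preimages are relatively open; ambient open sets `u w`
  -- with the same trace on `|K|` are used for the Lebesgue number.
  have hopen : ∀ w : L.vertices, ∃ u, IsOpen u ∧
      f ⁻¹' (antistar L w)ᶜ ∩ K.space = u ∩ K.space :=
    fun w => continuousOn_iff'.1 hf _ (isClosed_antistar hL w).isOpen_compl
  choose u hu hfu using hopen
  obtain ⟨δ, hδ, hball⟩ := lebesgue_number_lemma_of_metric (isCompact_space hK) hu (by
    intro x hx
    obtain ⟨w, hw, hxw⟩ := exists_notMem_antistar (hfL hx)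
    have : x ∈ f ⁻¹' (antistar L w)ᶜ ∩ K.space := ⟨hxw, hx⟩
    rw [hfu ⟨w, hw⟩] at this
    exact mem_iUnion.2 ⟨_, this.1⟩)
  refine ⟨δ, hδ, fun K' ε hε hsp hmesh v hv => ?_⟩
  obtain ⟨w, hw⟩ := hball v (hsp (SimplicialComplex.vertices_subset_space hv))
  refine ⟨w, w.2, ?_⟩
  rintro _ ⟨x, hx, rfl⟩
  have hxK := hsp (closedStarSpace_subset_space K' v hx)
  -- The strict inequality `ε < δ` fits the closed ball of radius `ε` into the open Lebesgue ball.
  have hxu : x ∈ u w ∩ K.space :=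
    ⟨hw (Metric.closedBall_subset_ball hε (closedStarSpace_subset_closedBall hmesh v hx)), hxK⟩
  rw [← hfu w] at hxu
  exact mem_openStar_of_notMem_antistar (hfL hxK) hxu.1

/-- If the meshes of a sequence of complexes inside `|K|` tend to `0`, then both loops stop. -/
theorem terminates_of_meshLE {K : SimplicialComplex ℝ E} {L : SimplicialComplex ℝ F}
    (hK : K.faces.Finite) (hL : L.faces.Finite) {f : E → F} (hf : ContinuousOn f K.space)
    (hfL : MapsTo f K.space L.space) {S : ℕ → SimplicialComplex ℝ E} {ε : ℕ → ℝ}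
    (hS : ∀ i, (S i).space ⊆ K.space) (hmesh : ∀ i, MeshLE (S i) (ε i))
    (hε : Filter.Tendsto ε Filter.atTop (nhds 0)) :
    Terminates f S L WeakStarCondition ∧ Terminates f S L StarCondition := by
  obtain ⟨δ, hδ, h⟩ := exists_forall_starCondition hK hL hf hfL
  obtain ⟨i, hi⟩ := (hε.eventually (gt_mem_nhds hδ)).exists
  exact terminates_of_exists_starCondition ⟨i, h _ _ hi (hS i) (hmesh i)⟩

end Mesh

/-! ### Mesh of the barycentric subdivision -/

section Barycentric

variable {E : Type*} [NormedAddCommGroup E] [NormedSpace ℝ E]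

theorem barycenter_mem_convexHull {s : Finset E} (hs : s.Nonempty) :
    barycenter s ∈ convexHull ℝ (s : Set E) := by
  rw [barycenter, Finset.smul_sum]
  refine (convex_convexHull ℝ _).sum_mem (fun _ _ => by positivity) ?_
    fun v hv => subset_convexHull ℝ _ hv
  rw [Finset.sum_const, nsmul_eq_mul, mul_inv_cancel₀]
  exact_mod_cast hs.card_pos.ne'

/-- A flag has a largest member. -/
theorem exists_top_of_mem_flags {K : SimplicialComplex ℝ E} {C : Finset (Finset E)}
    (hC : C ∈ flags K) : ∃ t ∈ C, ∀ s ∈ C, s ⊆ t := by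
  obtain ⟨t, ht, hmax⟩ := Finset.exists_max_image C (fun s : Finset E => s.card) hC.1
  refine ⟨t, ht, fun s hs => ?_⟩
  rcases hC.2.2 s hs t ht with h | h
  · exact h
  · exact (Finset.eq_of_subset_of_card_le h (hmax s hs)).ge

/-- All barycenters of a flag lie in the hull of its largest member. -/
theorem space_barycentricSubdivision_subset (K : SimplicialComplex ℝ E) :
    (barycentricSubdivision K).space ⊆ K.space := by
  refine iUnion₂_subset ?_
  rintro t ⟨C, hC, ht⟩
  obtain ⟨s, hs, hmax⟩ := exists_top_of_mem_flags hC
  refine (convexHull_min ?_ (convex_convexHull ℝ (s : Set E))).trans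
    (SimplicialComplex.convexHull_subset_space (hC.2.1 s hs))
  rw [ht]
  rintro _ ⟨r, hr, rfl⟩
  exact convexHull_mono (Finset.coe_subset.2 (hmax r hr))
    (barycenter_mem_convexHull (K.nonempty_of_mem_faces (hC.2.1 r hr)))

/-- The vector `v - barycenter s` is the average of the `v - u` over `u ∈ s`. The term `u = v`
vanishes, which leaves `s.card - 1` terms of norm at most `δ`. -/
theorem dist_barycenter_le {s : Finset E} {δ : ℝ} (h : ∀ x ∈ s, ∀ y ∈ s, dist x y ≤ δ) {v : E}
    (hv : v ∈ s) : dist v (barycenter s) ≤ (s.card - 1) / s.card * δ := by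
  classical
  have hs0 : (s.card : ℝ) ≠ 0 := by exact_mod_cast (Finset.card_pos.2 ⟨v, hv⟩).ne'
  have e : v - barycenter s = (s.card : ℝ)⁻¹ • ∑ u ∈ s.erase v, (v - u) := by
    rw [Finset.sum_erase _ (sub_self v), Finset.sum_sub_distrib, Finset.sum_const, smul_sub,
      ← Nat.cast_smul_eq_nsmul ℝ, smul_smul, inv_mul_cancel₀ hs0, one_smul, barycenter]
  have hsum : ‖∑ u ∈ s.erase v, (v - u)‖ ≤ (s.card - 1) * δ := by
    refine (norm_sum_le_of_le _ fun u hu => (dist_eq_norm v u).symm.trans_le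
      (h v hv u (Finset.mem_of_mem_erase hu))).trans_eq ?_
    rw [Finset.sum_const, nsmul_eq_mul, Finset.cast_card_erase_of_mem hv]
  rw [dist_eq_norm, e, norm_smul, norm_inv, Real.norm_natCast]
  calc (s.card : ℝ)⁻¹ * ‖∑ u ∈ s.erase v, (v - u)‖ ≤ (s.card : ℝ)⁻¹ * ((s.card - 1) * δ) := by gcongr
    _ = _ := by ring

/-- An edge joins the barycenters of nested simplices `s ⊆ t`. The ball around `barycenter t` that
contains the vertices of `t` contains their hull, hence also `barycenter s`. -/
theorem MeshLE.barycentricSubdivision [FiniteDimensional ℝ E] {K : SimplicialComplex ℝ E} {δ : ℝ} (hδ : 0 ≤ δ)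
    (h : MeshLE K δ) : MeshLE (barycentricSubdivision K)
      (Module.finrank ℝ E / (Module.finrank ℝ E + 1) * δ) := by
  have key : ∀ s t : Finset E, s.Nonempty → t ∈ K.faces → s ⊆ t →
      dist (barycenter s) (barycenter t) ≤ Module.finrank ℝ E / (Module.finrank ℝ E + 1) * δ := by
    intro s t hs ht hst
    have hball : convexHull ℝ (t : Set E) ⊆
        Metric.closedBall (barycenter t) ((t.card - 1) / t.card * δ) :=
      convexHull_min (fun v hv => dist_barycenter_le (h t ht) hv) (convex_closedBall _ _)
    refine (Metric.mem_closedBall.1 (hball (convexHull_mono (Finset.coe_subset.2 hst)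
      (barycenter_mem_convexHull hs)))).trans (mul_le_mul_of_nonneg_right ?_ hδ)
    -- Affine independence bounds the number of vertices, and `(k - 1) / k` increases with `k`; this
    -- makes the factor the same at every stage.
    have hcard : (t.card : ℝ) ≤ Module.finrank ℝ E + 1 := by
      have := (K.indep ht).card_le_finrank_succ
      rw [Fintype.card_coe] at this
      have h2 : t.card ≤ Module.finrank ℝ E + 1 :=
        this.trans (Nat.succ_le_succ (Submodule.finrank_le _))
      exact_mod_cast h2
    have hpos : (0 : ℝ) < t.card := by exact_mod_cast (K.nonempty_of_mem_faces ht).card_pos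
    rw [div_le_div_iff₀ hpos (by positivity)]
    linarith
  rintro u ⟨C, hC, hu⟩ x hx y hy
  rw [← Finset.mem_coe, hu] at hx hy
  obtain ⟨s, hs, rfl⟩ := hx
  obtain ⟨t, ht, rfl⟩ := hy
  rcases hC.2.2 s hs t ht with hst | hst
  · exact key s t (K.nonempty_of_mem_faces (hC.2.1 s hs)) (hC.2.1 t ht) hst
  · rw [dist_comm]
    exact key t s (K.nonempty_of_mem_faces (hC.2.1 t ht)) (hC.2.1 s hs) hst

theorem MeshLE.iterate_barycentricSubdivision [FiniteDimensional ℝ E]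
    {K : SimplicialComplex ℝ E} {δ : ℝ} (hδ : 0 ≤ δ) (h : MeshLE K δ) (i : ℕ) : MeshLE (SimplicialApprox.barycentricSubdivision^[i] K)
      ((Module.finrank ℝ E / (Module.finrank ℝ E + 1) : ℝ) ^ i * δ) := by
  induction i with
  | zero => simpa using h
  | succ i ih =>
    rw [Function.iterate_succ_apply', pow_succ', mul_assoc]
    exact ih.barycentricSubdivision (by positivity)

theorem space_iterate_barycentricSubdivision_subset (K : SimplicialComplex ℝ E) (i : ℕ) :
    (SimplicialApprox.barycentricSubdivision^[i] K).space ⊆ K.space := by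
  induction i with
  | zero => exact Subset.rfl
  | succ i ih =>
    rw [Function.iterate_succ_apply']
    exact (space_barycentricSubdivision_subset _).trans ih

end Barycentric

/-! ### Monotone affine functions and the edgewise subdivision -/

section Edgewise

variable {E : Type*} [AddCommGroup E] [Module ℝ E]

/-- `φ` is monotone on `s` with respect to `le`, and varies by at most `R` there. -/
def MonotoneWithin (le : E → E → Prop) (s : Finset E) (R : ℝ) (φ : E → ℝ) : Prop :=
  ∀ a ∈ s, ∀ b ∈ s, le a b → φ a ≤ φ b ∧ φ b ≤ φ a + R

/-- Along a scheme `a₀ ≤ a₁ ≤ b₀ ≤ b₁`, the steps from `a₀` to `a₁` and from `b₀` to `b₁` do not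
overlap, so that the variation of a monotone affine function is halved. -/
theorem monotoneWithin_midpointLE {K : OrderedComplex E} {P : Finset (E × E)} (hP : P ∈ K.schemes)
    {s t : Finset E} (hs : ∀ p ∈ P, p.1 ∈ s ∧ p.2 ∈ s)
    (ht : (t : Set E) = (fun p : E × E => midpoint ℝ p.1 p.2) '' P) {R : ℝ} {φ : E →ᵃ[ℝ] ℝ}
    (h : MonotoneWithin K.le s R φ) : MonotoneWithin K.midpointLE t (R / 2) φ := by
  intro x hx y hy hxy
  rw [← Finset.mem_coe, ht] at hx hy
  obtain ⟨p, hp, rfl⟩ := hx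
  obtain ⟨q, hq, rfl⟩ := hy
  dsimp only at hxy ⊢
  have hpq := (K.midpointLE_iff hP hp hq).1 hxy
  have h1 := h _ (hs p hp).1 _ (hs q hq).1 hpq.1
  have h2 := h _ (hs p hp).2 _ (hs q hq).2 hpq.2
  -- Since `φ q.1 ≤ φ p.2` and `φ q.2 ≤ φ p.1 + R`, the increments from `p` to `q` in the two
  -- entries add up to at most `R`, not `2 * R`; the midpoint then halves this.
  have h3 := h _ (hs q hq).1 _ (hs p hp).2 (hP.2.2 q hq p hp).1
  have h4 := h _ (hs p hp).1 _ (hs q hq).2 (hP.2.2 p hp q hq).1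
  rw [φ.map_midpoint, φ.map_midpoint, midpoint_eq_smul_add, midpoint_eq_smul_add]
  simp only [invOf_eq_inv, smul_eq_mul]
  constructor <;> linarith

/-- Each simplex `t` of an iterated edgewise subdivision lies in a simplex `s` of the original
complex, and affine functions that are monotone on `s` are monotone on `t`, with variation reduced
by the scale of the subdivision. -/
theorem exists_carrier_iterate_edgewiseSubdivision (K : OrderedComplex E) (i : ℕ) :
    ∀ t ∈ (edgewiseSubdivision^[i] K).complex.faces, ∃ s ∈ K.complex.faces,
      (t : Set E) ⊆ convexHull ℝ (s : Set E) ∧ ∀ (R : ℝ) (φ : E →ᵃ[ℝ] ℝ),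
        MonotoneWithin K.le s R φ →
        MonotoneWithin (edgewiseSubdivision^[i] K).le t (R / 2 ^ i) φ := by
  induction i with
  | zero => exact fun t ht => ⟨t, ht, subset_convexHull ℝ _, fun R φ h => by simpa using h⟩
  | succ i ih =>
    rw [Function.iterate_succ_apply']
    rintro t ⟨P, hP, ht⟩
    obtain ⟨r, hr, hPr⟩ := hP.2.1
    obtain ⟨s, hs, hrs, hmono⟩ := ih r hr
    refine ⟨s, hs, ?_, fun R φ h => ?_⟩
    · rw [ht]
      rintro _ ⟨p, hp, rfl⟩
      exact (convex_convexHull ℝ _).midpoint_mem (hrs (hPr p hp).1) (hrs (hPr p hp).2)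
    · rw [pow_succ, ← div_div]
      exact monotoneWithin_midpointLE hP hPr ht (hmono R φ h)

/-- The barycentric coordinates of an affinely independent set extend to affine functions. -/
theorem exists_affineMap_coord [DecidableEq E] {s : Finset E}
    (hs : AffineIndependent ℝ ((↑) : s → E)) :
    ∃ c : E → E →ᵃ[ℝ] ℝ, ∀ u ∈ s, ∀ v ∈ s, c u v = if u = v then 1 else 0 := by
  -- The vertices are completed to an affine basis of `E`, whose coordinate functions are defined
  -- everywhere. Outside `B` the value `0` is a filler.
  obtain ⟨B, hsB, hB, htop⟩ := exists_subset_affineIndependent_affineSpan_eq_top (k := ℝ)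
    (V := E) (P := E) (s := (s : Set E)) hs
  let b : AffineBasis B ℝ E := ⟨(↑), hB, by rw [Subtype.range_coe]; exact htop⟩
  classical
  refine ⟨fun u => if h : u ∈ B then b.coord ⟨u, h⟩ else 0, fun u hu v hv => ?_⟩
  dsimp only
  rw [dif_pos (hsB hu)]
  exact (b.coord_apply ⟨u, hsB hu⟩ ⟨v, hsB hv⟩).trans (if_congr Subtype.mk_eq_mk rfl rfl)

/-- The identity is affine in `x`, so it holds on a convex set, and this set contains the vertices.
-/
theorem affineMap_coord_sum {s : Finset E} {c : E → E →ᵃ[ℝ] ℝ} [DecidableEq E]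
    (hc : ∀ u ∈ s, ∀ v ∈ s, c u v = if u = v then 1 else 0) {x : E}
    (hx : x ∈ convexHull ℝ (s : Set E)) : ∑ u ∈ s, c u x • u = x := by
  have hconv : Convex ℝ {x | ∑ u ∈ s, c u x • u = x} := by
    intro x hx y hy a b ha hb hab
    simp only [mem_ofPred_eq] at hx hy ⊢
    have e : ∀ u, c u (a • x + b • y) = a • c u x + b • c u y := fun u =>
      Convex.combo_affine_apply hab
    simp only [e, add_smul, smul_assoc, Finset.sum_add_distrib]
    rw [← Finset.smul_sum, ← Finset.smul_sum, hx, hy]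
  refine convexHull_min (fun v hv => ?_) hconv hx
  simp only [mem_ofPred_eq]
  rw [Finset.sum_congr rfl fun u hu => by rw [hc u hu v hv], Finset.sum_eq_single_of_mem v hv
    fun u _ hne => by rw [if_neg hne, zero_smul], if_pos rfl, one_smul]

theorem affineMap_sum_apply (U : Finset E) (c : E → E →ᵃ[ℝ] ℝ) (a : E) :
    (∑ v ∈ U, c v) a = ∑ v ∈ U, c v a :=
  map_sum (⟨⟨fun φ : E →ᵃ[ℝ] ℝ => φ a, rfl⟩, fun _ _ => rfl⟩ : (E →ᵃ[ℝ] ℝ) →+ ℝ) c U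

/-- Barycentric coordinates are differences of affine functions that are monotone with
variation `1`. -/
theorem exists_monotoneWithin_sub {K : OrderedComplex E} {s : Finset E} (hs : s ∈ K.complex.faces)
    {c : E → E →ᵃ[ℝ] ℝ} [DecidableEq E]
    (hc : ∀ u ∈ s, ∀ v ∈ s, c u v = if u = v then 1 else 0) {u : E} (hu : u ∈ s) :
    ∃ φ ψ : E →ᵃ[ℝ] ℝ, c u = φ - ψ ∧ MonotoneWithin K.le s 1 φ ∧ MonotoneWithin K.le s 1 ψ := by
  classical
  -- The coordinates over `U` sum to an affine function that is the indicator of `U` on the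
  -- vertices; it is monotone with variation `1` when `U` is closed upwards.
  have ind : ∀ U ⊆ s, (∀ a ∈ U, ∀ b ∈ s, K.le a b → b ∈ U) →
      MonotoneWithin K.le s 1 (∑ v ∈ U, c v : E →ᵃ[ℝ] ℝ) := by
    intro U hU hup
    have val : ∀ a ∈ s, (∑ v ∈ U, c v : E →ᵃ[ℝ] ℝ) a = if a ∈ U then 1 else 0 := by
      intro a ha
      rw [affineMap_sum_apply, Finset.sum_congr rfl fun v hv => hc v (hU hv) a ha, Finset.sum_ite_eq']
    intro a ha b hb hab
    rw [val a ha, val b hb]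
    by_cases haU : a ∈ U
    · rw [if_pos haU, if_pos (hup a haU b hb hab)]
      norm_num
    · rw [if_neg haU]
      split_ifs <;> norm_num
  have hrefl : K.le u u := (K.total s hs u hu u hu).elim id id
  have huU : u ∈ s.filter (K.le u) := Finset.mem_filter.2 ⟨hu, hrefl⟩
  -- The up-sets `{v | u ≤ v}` and `{v | u < v}` differ exactly by `u`.
  refine ⟨∑ v ∈ s.filter (K.le u), c v, ∑ v ∈ (s.filter (K.le u)).erase u, c v, ?_, ?_, ?_⟩
  · rw [← Finset.add_sum_erase _ c huU, add_sub_cancel_right]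
  · refine ind _ (Finset.filter_subset _ _) fun a ha b hb hab => ?_
    rw [Finset.mem_filter] at ha ⊢
    exact ⟨hb, K.trans s hs u hu a ha.1 b hb ha.2 hab⟩
  · refine ind _ ((Finset.erase_subset _ _).trans (Finset.filter_subset _ _))
      fun a ha b hb hab => ?_
    rw [Finset.mem_erase, Finset.mem_filter] at ha ⊢
    refine ⟨?_, hb, K.trans s hs u hu a ha.2.1 b hb ha.2.2 hab⟩
    rintro rfl
    exact ha.1 (K.antisymm s hs a ha.2.1 b hu hab ha.2.2)

theorem space_iterate_edgewiseSubdivision_subset (K : OrderedComplex E) (i : ℕ) :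
    (edgewiseSubdivision^[i] K).complex.space ⊆ K.complex.space := by
  refine iUnion₂_subset fun t ht => ?_
  obtain ⟨s, hs, hts, -⟩ := exists_carrier_iterate_edgewiseSubdivision K i t ht
  exact (convexHull_min hts (convex_convexHull ℝ _)).trans
    (SimplicialComplex.convexHull_subset_space hs)

end Edgewise

/-- The difference of two points of `s` is the combination of the vertices `u` of `s` with the
differences of coordinates as coefficients. These are at most `1 / 2 ^ i` in size along an edge, so
the length is at most `1 / 2 ^ i` times the sum of the `‖u‖`. -/
theorem meshLE_iterate_edgewiseSubdivision {E : Type*} [NormedAddCommGroup E] [NormedSpace ℝ E]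
    (K : OrderedComplex E) {M : ℝ} (hM : ∀ s ∈ K.complex.faces, ∑ u ∈ s, ‖u‖ ≤ M) (i : ℕ) :
    MeshLE (edgewiseSubdivision^[i] K).complex (M / 2 ^ i) := by
  classical
  intro t ht
  obtain ⟨s, hs, hts, hmono⟩ := exists_carrier_iterate_edgewiseSubdivision K i t ht
  obtain ⟨c, hc⟩ := exists_affineMap_coord (K.complex.indep hs)
  have key : ∀ x ∈ t, ∀ y ∈ t, (edgewiseSubdivision^[i] K).le x y → dist x y ≤ M / 2 ^ i := by
    intro x hx y hy hxy
    have hcu : ∀ u ∈ s, |c u x - c u y| ≤ 1 / 2 ^ i := by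
      intro u hu
      obtain ⟨φ, ψ, e, hφ, hψ⟩ := exists_monotoneWithin_sub hs hc hu
      -- Both `φ` and `ψ` increase from `x` to `y` by an amount in `[0, 1 / 2 ^ i]`, so the
      -- increments of their difference stay within `1 / 2 ^ i` and no factor `2` appears.
      have h1 := hmono 1 φ hφ x hx y hy hxy
      have h2 := hmono 1 ψ hψ x hx y hy hxy
      rw [e, AffineMap.coe_sub, Pi.sub_apply, Pi.sub_apply, abs_le]
      constructor <;> linarith
    rw [dist_eq_norm, ← affineMap_coord_sum hc (hts hx), ← affineMap_coord_sum hc (hts hy),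
      ← Finset.sum_sub_distrib]
    simp only [← sub_smul]
    have hpow : (0 : ℝ) ≤ 1 / 2 ^ i := by positivity
    calc _ ≤ ∑ u ∈ s, 1 / 2 ^ i * ‖u‖ := norm_sum_le_of_le _ fun u hu => by
            rw [norm_smul]
            exact mul_le_mul_of_nonneg_right (hcu u hu) (norm_nonneg u)
      _ = 1 / 2 ^ i * ∑ u ∈ s, ‖u‖ := by rw [Finset.mul_sum]
      _ ≤ 1 / 2 ^ i * M := mul_le_mul_of_nonneg_left (hM s hs) hpow
      _ = M / 2 ^ i := by ring
  intro x hx y hy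
  rcases (edgewiseSubdivision^[i] K).total t ht x hx y hy with h | h
  · exact key x hx y hy h
  · rw [dist_comm]
    exact key y hy x hx h

end SimplicialApprox

/-! ### Termination for both subdivisions -/

theorem mainTheorem9 {n m : ℕ}
    (K : Geometry.SimplicialComplex ℝ (EuclideanSpace ℝ (Fin n)))
    (L : Geometry.SimplicialComplex ℝ (EuclideanSpace ℝ (Fin m)))
    (hK : K.faces.Finite) (hL : L.faces.Finite)
    (f : EuclideanSpace ℝ (Fin n) → EuclideanSpace ℝ (Fin m))
    (hf : ContinuousOn f K.space) (hfL : Set.MapsTo f K.space L.space) :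
    (SimplicialApprox.Terminates f
        (fun i => SimplicialApprox.barycentricSubdivision^[i] K) L
        SimplicialApprox.WeakStarCondition ∧
      SimplicialApprox.Terminates f
        (fun i => SimplicialApprox.barycentricSubdivision^[i] K) L
        SimplicialApprox.StarCondition) ∧
    (∀ O : SimplicialApprox.OrderedComplex (EuclideanSpace ℝ (Fin n)), O.complex = K →
      SimplicialApprox.Terminates f
        (fun i => (SimplicialApprox.edgewiseSubdivision^[i] O).complex) L
        SimplicialApprox.WeakStarCondition ∧
      SimplicialApprox.Terminates f
        (fun i => (SimplicialApprox.edgewiseSubdivision^[i] O).complex) L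
        SimplicialApprox.StarCondition) := by
  constructor
  · obtain ⟨δ, hδ⟩ := SimplicialApprox.exists_meshLE hK
    -- The bound `δ` could be negative when `K` has no simplices.
    have hδ' : SimplicialApprox.MeshLE K (max δ 0) :=
      fun s hs x hx y hy => (hδ s hs x hx y hy).trans (le_max_left _ _)
    refine SimplicialApprox.terminates_of_meshLE hK hL hf hfL
      (SimplicialApprox.space_iterate_barycentricSubdivision_subset K)
      (hδ'.iterate_barycentricSubdivision (le_max_right _ _)) ?_
    have hr : (Module.finrank ℝ (EuclideanSpace ℝ (Fin n)) /
        (Module.finrank ℝ (EuclideanSpace ℝ (Fin n)) + 1) : ℝ) < 1 := by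
      rw [div_lt_one (by positivity)]
      exact lt_add_one _
    have h := (tendsto_pow_atTop_nhds_zero_of_lt_one (by positivity) hr).mul_const (max δ 0)
    rwa [zero_mul] at h
  · rintro O rfl
    -- `M` depends only on the original simplices, so the bound `M / 2 ^ i` is uniform at each
    -- stage.
    obtain ⟨M, hM⟩ := (hK.image fun s : Finset (EuclideanSpace ℝ (Fin n)) => ∑ u ∈ s, ‖u‖).bddAbove
    refine SimplicialApprox.terminates_of_meshLE hK hL hf hfL
      (SimplicialApprox.space_iterate_edgewiseSubdivision_subset O)
      (SimplicialApprox.meshLE_iterate_edgewiseSubdivision O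
        fun s hs => hM (Set.mem_image_of_mem _ hs)) ?_
    have h := (tendsto_pow_atTop_nhds_zero_of_lt_one (r := (1 / 2 : ℝ)) (by norm_num)
      (by norm_num)).const_mul M
    rw [mul_zero] at h
    refine h.congr fun i => ?_
    rw [div_pow, one_pow, mul_one_div]
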